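/- Let $f:[0,1]\to[0,1]$, $f(x)=2x \bmod 1$ (the fractional part of $2x$), be the doubling map, let $\mathrm{Leb}$ be Lebesgue measure on $[0,1]$, and for $n\in\mathbb N$, $r\ge 0$ and $x\in[0,1]$ put $$R_n(r,x)=\#\{\,j\in\{1,\dots,n\}:\ |x-f^j(x)|\le r\,\},$$ where $f^j$ is the $j$-th iterate of $f$. Then for every real $\tau>0$ and every integer $k\ge 0$, with $r_n=\frac{\tau}{2n}$, $$\lim_{n\to\infty}\mathrm{Leb}\bigl(\{x\in[0,1]:\ R_n(r_n,x)=k\}\bigr)=\frac{\tau^k}{k!}\,e^{-\tau}.$$ -/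

import Mathlib

/-- The recurrence counting function `R_n(r, x) = #{j ∈ [1, n] : d(x, f^j(x)) ≤ r}` of a
self-map `f` of a metric space. -/
noncomputable def recurrenceCount {X : Type*} [PseudoMetricSpace X] (f : X → X)
    (n : ℕ) (r : ℝ) (x : X) : ℕ :=
  open Classical in
  ((Finset.Icc 1 n).filter fun j : ℕ => dist x (f^[j] x) ≤ r).card

/-- The doubling map `x ↦ 2x mod 1` of the unit interval `[0, 1]`. -/
noncomputable def doublingMap (x : unitInterval) : unitInterval :=
  ⟨Int.fract (2 * (x : ℝ)), Int.fract_nonneg _, (Int.fract_lt_one _).le⟩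

/-! In binary, `f^j` deletes the first `j` digits of `x`. Replace "distance at most `r`" by a
condition on blocks of `L` digits: the first block and the one after position `j` differ by at most
`K = ⌊r * 2^L⌋` modulo `2^L`. For `j ≥ L` such a dyadic return has probability exactly `p =
(2K+1)/2^L`. It is independent of the first block together with all digits beyond `j + L`, so it is
independent of dyadic returns at times at least `j + L` (`unitMeasure_dyadicReturn_and`).

Two returns less than `L` apart are the only obstruction to a binomial law. Both landing near the
first block forces the orbit to return near itself, so their joint probability is `O(p^2)`
(`unitMeasure_dyadicReturn_inter_le`). Peeling off one time at a time then gives the binomial law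
with `n` trials up to `O(n L p^2)` (`abs_dyadicCount_sub_binomialWeight_le`).

True and dyadic counts agree off a set of small measure (`abs_returnCount_sub_dyadicCount_le`). With
`L = ⌊√n⌋` one has `n p → τ`, `L / n → 0` and `n / 2^L → 0`, so all errors vanish and the Poisson
limit of the binomial law concludes. -/

open MeasureTheory Set

/-! ### Lebesgue measure under `x ↦ M * x mod 1`. -/

/-- Lebesgue measure on `[0, 1)`, as a measure on the real line. -/
noncomputable def unitMeasure : Measure ℝ := volume.restrict (Ico 0 1)

instance : IsProbabilityMeasure unitMeasure :=
  ⟨by simp [unitMeasure]⟩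

theorem unitMeasure_real_apply (S : Set ℝ) :
    unitMeasure.real S = volume.real (S ∩ Ico 0 1) :=
  measureReal_restrict_apply' measurableSet_Ico

/-- The integer part and the fractional part of `M * x` are independent, the former being uniform
on `{0, …, M - 1}` and the latter on `[0, 1)`. -/
theorem unitMeasure_floor_fract {M : ℕ} (hM : 0 < M) (Q : ℕ → ℝ → Prop)
    (hQ : ∀ w, MeasurableSet {y | Q w y}) :
    unitMeasure.real {x | Q ⌊(M : ℝ) * x⌋₊ (Int.fract ((M : ℝ) * x))} =
      (∑ w ∈ Finset.range M, unitMeasure.real {y | Q w y}) / M := by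
  have hM' : (0 : ℝ) < M := by exact_mod_cast hM
  have hset : {x | Q ⌊(M : ℝ) * x⌋₊ (Int.fract ((M : ℝ) * x))} ∩ Ico 0 1 =
      ⋃ w ∈ Finset.range M, ((M : ℝ) * ·) ⁻¹' ((· + (-(w : ℝ))) ⁻¹' ({y | Q w y} ∩ Ico 0 1)) := by
    ext x
    simp only [mem_inter_iff, mem_ofPred_eq, mem_Ico, mem_iUnion, Finset.mem_range, mem_preimage,
      exists_prop]
    constructor
    · rintro ⟨h, h0, h1⟩
      have hx : 0 ≤ (M : ℝ) * x := by positivity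
      have hfr : (M : ℝ) * x + -((⌊(M : ℝ) * x⌋₊ : ℕ) : ℝ) = Int.fract ((M : ℝ) * x) := by
        rw [Int.fract, natCast_floor_eq_intCast_floor hx]; ring
      refine ⟨⌊(M : ℝ) * x⌋₊, ?_, ?_, ?_, ?_⟩
      · rw [Nat.floor_lt hx]; nlinarith
      · rwa [hfr]
      · rw [hfr]; exact Int.fract_nonneg _
      · rw [hfr]; exact Int.fract_lt_one _
    · rintro ⟨w, hw, h, h0, h1⟩
      have hw' : (w : ℝ) + 1 ≤ M := by exact_mod_cast hw
      have hw0 : (0 : ℝ) ≤ w := by positivity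
      have hfl : ⌊(M : ℝ) * x⌋₊ = w := by
        rw [Nat.floor_eq_iff (by linarith)]; constructor <;> linarith
      have hfl' : ⌊(M : ℝ) * x⌋ = (w : ℤ) := by
        rw [Int.floor_eq_iff]; push_cast; constructor <;> linarith
      refine ⟨?_, ?_, ?_⟩
      · rw [hfl, Int.fract, hfl']; simpa [sub_eq_add_neg] using h
      · by_contra hx; push Not at hx; nlinarith
      · by_contra hx; push Not at hx; nlinarith
  have hvol : ∀ w : ℕ, volume.real
      (((M : ℝ) * ·) ⁻¹' ((· + (-(w : ℝ))) ⁻¹' ({y | Q w y} ∩ Ico 0 1))) =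
      unitMeasure.real {y | Q w y} / M := by
    intro w
    rw [unitMeasure_real_apply, measureReal_def, Real.volume_preimage_mul_left hM'.ne',
      measure_preimage_add_right, ENNReal.toReal_mul, ENNReal.toReal_ofReal (abs_nonneg _),
      abs_of_pos (inv_pos.2 hM'), ← measureReal_def]
    field_simp
  rw [unitMeasure_real_apply, hset, measureReal_biUnion_finset (h := ?_)]
  · rw [Finset.sum_div]; exact Finset.sum_congr rfl fun w _ => hvol w
  · intro v _ w _ hvw
    refine Set.disjoint_left.2 fun x hx hx' => hvw ?_
    simp only [mem_preimage, mem_inter_iff, mem_Ico] at hx hx'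
    have h1 : (v : ℝ) < w + 1 := by linarith [hx.2.1, hx'.2.2]
    have h2 : (w : ℝ) < v + 1 := by linarith [hx.2.2, hx'.2.1]
    have h1' : v < w + 1 := by exact_mod_cast h1
    have h2' : w < v + 1 := by exact_mod_cast h2
    omega
  · intro w _
    exact (measurable_const_mul _) ((measurable_add_const _) ((hQ w).inter measurableSet_Ico))
  · intro w _
    rw [Real.volume_preimage_mul_left hM'.ne', measure_preimage_add_right]
    refine ENNReal.mul_ne_top ENNReal.ofReal_ne_top (ne_top_of_le_ne_top ?_
      (measure_mono inter_subset_right))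
    simp

theorem unitMeasure_fract {M : ℕ} (hM : 0 < M) {Q : ℝ → Prop} (hQ : MeasurableSet {y | Q y}) :
    unitMeasure.real {x | Q (Int.fract ((M : ℝ) * x))} = unitMeasure.real {y | Q y} := by
  rw [unitMeasure_floor_fract hM (fun _ => Q) fun _ => hQ]
  have : (M : ℝ) ≠ 0 := by exact_mod_cast hM.ne'
  simp [field]

/-- The points that return to a prescribed offset under `x ↦ M * x mod 1` up to an error `ε`. -/
theorem unitMeasure_return_le {M : ℕ} (hM : 2 ≤ M) (c : ℝ) {ε : ℝ} (hε : 0 ≤ ε) :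
    unitMeasure.real {x | |x - Int.fract ((M : ℝ) * x) - c| ≤ ε} ≤ 4 * ε := by
  have hM' : (2 : ℝ) ≤ M := by exact_mod_cast hM
  have hM1 : (0 : ℝ) < M - 1 := by linarith
  -- On the branch `⌊M * x⌋ = w` the displacement is `w - (M - 1) * x`, so the set lies in `M`
  -- intervals of length `2ε/(M - 1)`; the final `4` comes from `M/(M - 1) ≤ 2`.
  have hsub : {x | |x - Int.fract ((M : ℝ) * x) - c| ≤ ε} ∩ Ico 0 1 ⊆
      ⋃ w ∈ Finset.range M, Icc (((w : ℝ) - c - ε) / (M - 1)) (((w : ℝ) - c + ε) / (M - 1)) := by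
    rintro x ⟨hx, h0, h1⟩
    have hx0 : 0 ≤ (M : ℝ) * x := by positivity
    simp only [mem_iUnion, Finset.mem_range, exists_prop]
    refine ⟨⌊(M : ℝ) * x⌋₊, ?_, ?_⟩
    · rw [Nat.floor_lt hx0]; nlinarith
    · have hfr : Int.fract ((M : ℝ) * x) = (M : ℝ) * x - (⌊(M : ℝ) * x⌋₊ : ℕ) := by
        rw [Int.fract, natCast_floor_eq_intCast_floor hx0]
      rw [mem_ofPred_eq, hfr, abs_le] at hx
      rw [mem_Icc, div_le_iff₀ hM1, le_div_iff₀ hM1]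
      constructor <;> linarith [hx.1, hx.2]
  have hfin : volume (⋃ w ∈ Finset.range M,
      Icc (((w : ℝ) - c - ε) / (M - 1)) (((w : ℝ) - c + ε) / (M - 1))) ≠ ⊤ :=
    ((Finset.range M).finite_toSet.isCompact_biUnion fun w _ => isCompact_Icc).measure_ne_top
  rw [unitMeasure_real_apply]
  refine (measureReal_mono hsub hfin).trans ((measureReal_biUnion_finset_le _ _).trans ?_)
  have : ∀ w : ℕ, volume.real
      (Icc (((w : ℝ) - c - ε) / (M - 1)) (((w : ℝ) - c + ε) / (M - 1))) = 2 * ε / (M - 1) := by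
    intro w
    rw [Real.volume_real_Icc_of_le]
    · field_simp; ring
    · gcongr; linarith
  simp only [this, Finset.sum_const, Finset.card_range, nsmul_eq_mul]
  rw [mul_div_assoc', div_le_iff₀ hM1]
  nlinarith

/-! ### Proximity of residues modulo `M`. -/

/-- `a` and `v` are at distance at most `K` modulo `M`. -/
def CloseMod (M K a v : ℕ) : Prop :=
  ∃ d : ℤ, |d| ≤ K ∧ (v : ℤ) ≡ a + d [ZMOD M]

theorem CloseMod.symm {M K a v : ℕ} (h : CloseMod M K a v) : CloseMod M K v a := by
  obtain ⟨d, hd, h⟩ := h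
  refine ⟨-d, by rwa [abs_neg], ?_⟩
  simpa using (h.add_right (-d)).symm

theorem closeMod_comm {M K a v : ℕ} : CloseMod M K a v ↔ CloseMod M K v a :=
  ⟨CloseMod.symm, CloseMod.symm⟩

theorem CloseMod.trans {M K K' a v w : ℕ} (h : CloseMod M K a v) (h' : CloseMod M K' v w) :
    CloseMod M (K + K') a w := by
  obtain ⟨d, hd, h⟩ := h
  obtain ⟨d', hd', h'⟩ := h'
  refine ⟨d + d', (abs_add_le _ _).trans (by push_cast; linarith), ?_⟩
  simpa [add_assoc] using h'.trans (h.add_right d')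

-- The condition `2 * K + 1 ≤ M` keeps the offsets `-K, …, K` in distinct residue classes.
open Classical in
theorem card_closeMod {M K : ℕ} (hK : 2 * K + 1 ≤ M) (a : ℕ) :
    ((Finset.range M).filter fun v => CloseMod M K a v).card = 2 * K + 1 := by
  have hM : (0 : ℤ) < M := by omega
  have himg : ((Finset.range M).filter fun v => CloseMod M K a v) =
      (Finset.Icc (-(K : ℤ)) K).image fun d => (((a : ℤ) + d) % M).toNat := by
    ext v
    simp only [Finset.mem_filter, Finset.mem_range, Finset.mem_image, Finset.mem_Icc]
    constructor
    · rintro ⟨hv, d, hd, h⟩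
      refine ⟨d, abs_le.1 hd, ?_⟩
      rw [← h.eq, Int.emod_eq_of_lt (by omega) (by omega)]; simp
    · rintro ⟨d, hd, rfl⟩
      have h0 := Int.emod_nonneg ((a : ℤ) + d) hM.ne'
      have h1 := Int.emod_lt_of_pos ((a : ℤ) + d) hM
      refine ⟨by omega, d, abs_le.2 hd, ?_⟩
      rw [Int.toNat_of_nonneg h0]
      exact Int.mod_modEq _ _
  rw [himg, Finset.card_image_of_injOn]
  · simp; omega
  · intro d hd d' hd' h
    simp only [Finset.coe_Icc, mem_Icc] at hd hd'
    have h0 := Int.emod_nonneg ((a : ℤ) + d) hM.ne'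
    have h0' := Int.emod_nonneg ((a : ℤ) + d') hM.ne'
    have h2 : ((a : ℤ) + d) % M = (a + d') % M := by
      simp only at h; omega
    have h3 : (M : ℤ) ∣ d' - d := by
      have := (Int.ModEq.dvd (n := (M : ℤ)) h2)
      simpa using this
    obtain ⟨q, hq⟩ := h3
    have hq1 : q < 1 := by nlinarith
    have hq2 : -1 < q := by nlinarith
    have : q = 0 := by omega
    subst this; linarith

/-! ### Dyadic returns: probability and independence. -/

theorem fract_two_pow_mul_fract (i j : ℕ) (x : ℝ) :
    Int.fract ((2 : ℝ) ^ j * Int.fract ((2 : ℝ) ^ i * x)) = Int.fract ((2 : ℝ) ^ (i + j) * x) := by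
  rw [Int.fract_eq_fract]
  refine ⟨-(2 ^ j * ⌊(2 : ℝ) ^ i * x⌋), ?_⟩
  rw [Int.fract]
  push_cast
  ring

/-- The first `L` digits are independent of the tail after any position `j ≥ L`: the `j - L` digits
skipped in between are absorbed by invariance of the measure. -/
theorem unitMeasure_floor_fract_two_pow {L j : ℕ} (hj : L ≤ j) (Q : ℕ → ℝ → Prop)
    (hQ : ∀ w, MeasurableSet {y | Q w y}) :
    unitMeasure.real {x | Q ⌊(2 : ℝ) ^ L * x⌋₊ (Int.fract ((2 : ℝ) ^ j * x))} =
      (∑ w ∈ Finset.range (2 ^ L), unitMeasure.real {y | Q w y}) / 2 ^ L := by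
  obtain ⟨i, rfl⟩ := Nat.exists_eq_add_of_le hj
  have h := unitMeasure_floor_fract (M := 2 ^ L) (by positivity)
    (fun w y => Q w (Int.fract ((2 : ℝ) ^ i * y)))
    fun w => (measurable_fract.comp (measurable_const_mul ((2 : ℝ) ^ i))) (hQ w)
  have h' : ∀ w, unitMeasure.real {y | Q w (Int.fract ((2 : ℝ) ^ i * y))} =
      unitMeasure.real {y | Q w y} := fun w => by
    simpa using unitMeasure_fract (M := 2 ^ i) (by positivity) (hQ w)
  simp only [h', Nat.cast_pow, Nat.cast_ofNat, fract_two_pow_mul_fract] at h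
  exact h

/-- A discretization at scale `2 ^ (-L)` of the event that `x` is close to its `j`-th iterate,
closeness being understood on the circle. -/
def DyadicReturn (L K j : ℕ) (x : ℝ) : Prop :=
  CloseMod (2 ^ L) K ⌊(2 : ℝ) ^ L * x⌋₊ ⌊(2 : ℝ) ^ L * Int.fract ((2 : ℝ) ^ j * x)⌋₊

theorem measurable_floor_mul (c : ℝ) : Measurable fun x : ℝ => ⌊c * x⌋₊ :=
  Nat.measurable_floor.comp (measurable_const_mul c)

theorem measurable_floor_mul_fract (c d : ℝ) : Measurable fun x : ℝ => ⌊c * Int.fract (d * x)⌋₊ :=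
  (measurable_floor_mul c).comp (measurable_fract.comp (measurable_const_mul d))

theorem measurableSet_closeMod {M K : ℕ} {f g : ℝ → ℕ} (hf : Measurable f) (hg : Measurable g) :
    MeasurableSet {x | CloseMod M K (f x) (g x)} :=
  (hf.prodMk hg) (MeasurableSet.of_discrete (s := {q : ℕ × ℕ | CloseMod M K q.1 q.2}))

theorem measurableSet_dyadicReturn (L K j : ℕ) : MeasurableSet {x | DyadicReturn L K j x} :=
  measurableSet_closeMod (measurable_floor_mul _) (measurable_floor_mul_fract _ _)

open Classical in
theorem measurableSet_card_filter_eq {P : ℕ → ℝ → Prop} (hP : ∀ j, MeasurableSet {x | P j x})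
    (s : Finset ℕ) (k : ℕ) : MeasurableSet {x | (s.filter fun j => P j x).card = k} := by
  have : Measurable fun x => (s.filter fun j => P j x).card := by
    simp only [Finset.card_filter]
    exact Finset.measurable_sum _ fun j _ => Measurable.ite (hP j) measurable_const measurable_const
  exact this (measurableSet_singleton k)

/-- A dyadic return at time `j` is independent of the first `L` binary digits together with the
digits after position `j + L`. -/
theorem unitMeasure_dyadicReturn_and {L K j : ℕ} (hK : 2 * K + 1 ≤ 2 ^ L) (hj : L ≤ j)
    (Q : ℕ → ℝ → Prop) (hQ : ∀ w, MeasurableSet {y | Q w y}) :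
    unitMeasure.real {x | DyadicReturn L K j x ∧
        Q ⌊(2 : ℝ) ^ L * x⌋₊ (Int.fract ((2 : ℝ) ^ (j + L) * x))} =
      (2 * K + 1) / 2 ^ L *
        unitMeasure.real {x | Q ⌊(2 : ℝ) ^ L * x⌋₊ (Int.fract ((2 : ℝ) ^ (j + L) * x))} := by
  classical
  rw [unitMeasure_floor_fract_two_pow (hj.trans (Nat.le_add_right _ _)) Q hQ]
  have h := unitMeasure_floor_fract_two_pow hj
    (fun w y => CloseMod (2 ^ L) K w ⌊(2 : ℝ) ^ L * y⌋₊ ∧ Q w (Int.fract ((2 : ℝ) ^ L * y)))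
    fun w => (measurableSet_closeMod measurable_const (measurable_floor_mul _)).inter
      ((measurable_fract.comp (measurable_const_mul ((2 : ℝ) ^ L))) (hQ w))
  simp only [fract_two_pow_mul_fract] at h
  simp only [DyadicReturn, h]
  -- With the first block `w` frozen, `y` is the tail after position `j`; its leading block is
  -- uniform and independent of the rest, and `2K + 1` of its values are close to `w`.
  have h' : ∀ w, unitMeasure.real {y | CloseMod (2 ^ L) K w ⌊(2 : ℝ) ^ L * y⌋₊ ∧
      Q w (Int.fract ((2 : ℝ) ^ L * y))} = (2 * K + 1) / 2 ^ L * unitMeasure.real {y | Q w y} := by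
    intro w
    rw [unitMeasure_floor_fract_two_pow le_rfl (fun v y => CloseMod (2 ^ L) K w v ∧ Q w y)
      fun v => (MeasurableSet.const _).inter (hQ w)]
    have : ∀ v, unitMeasure.real {y | CloseMod (2 ^ L) K w v ∧ Q w y} =
        if CloseMod (2 ^ L) K w v then unitMeasure.real {y | Q w y} else 0 := by
      intro v
      split_ifs with hv <;> simp [hv]
    simp only [this, ← Finset.sum_filter, Finset.sum_const, card_closeMod hK, nsmul_eq_mul]
    push_cast
    ring
  simp only [h', ← Finset.mul_sum]
  ring

theorem unitMeasure_dyadicReturn {L K j : ℕ} (hK : 2 * K + 1 ≤ 2 ^ L) (hj : L ≤ j) :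
    unitMeasure.real {x | DyadicReturn L K j x} = (2 * K + 1) / 2 ^ L := by
  simpa using unitMeasure_dyadicReturn_and hK hj (fun _ _ => True) fun _ => MeasurableSet.univ

/-- Both residues lie in `[0, M)` and the offset is below `M`, so the circle is wrapped around at
most once. -/
theorem closeMod_cases {M K v w : ℕ} (hK : K < M) (hv : v < M) (hw : w < M)
    (h : CloseMod M K v w) :
    ∃ q : ℤ, (q = -1 ∨ q = 0 ∨ q = 1) ∧ |(w : ℤ) - v - q * M| ≤ K := by
  obtain ⟨d, hd, h⟩ := h
  obtain ⟨q, hq⟩ := h.symm.dvd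
  have hd' := abs_le.1 hd
  refine ⟨q, ?_, ?_⟩
  · have h1 : q < 2 := by nlinarith
    have h2 : -2 < q := by nlinarith
    omega
  · rwa [show (w : ℤ) - v - q * M = d by linarith]

theorem mul_floor_bounds {c x : ℝ} (hc : 0 < c) (h0 : 0 ≤ x) :
    (⌊c * x⌋₊ : ℝ) ≤ c * x ∧ c * x < ⌊c * x⌋₊ + 1 :=
  ⟨Nat.floor_le (by positivity), Nat.lt_floor_add_one _⟩

theorem floor_two_pow_mul_lt {L : ℕ} {x : ℝ} (h0 : 0 ≤ x) (h1 : x < 1) :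
    ⌊(2 : ℝ) ^ L * x⌋₊ < 2 ^ L := by
  rw [Nat.floor_lt (by positivity)]
  have : (0 : ℝ) < 2 ^ L := by positivity
  push_cast
  nlinarith

/-- This covers gaps `g < L`, where the two blocks overlap and are not independent. Rounding costs
at most `1 / 2^L`, so the displacement is within `(K + 1) / 2^L` of `-1`, `0` or `1`, each at cost
`4 * ((K + 1) / 2^L)`. -/
theorem unitMeasure_dyadicReturn_le {L K g : ℕ} (hK : K < 2 ^ L) (hg : 1 ≤ g) :
    unitMeasure.real {x | DyadicReturn L K g x} ≤ 12 * ((K + 1) / 2 ^ L) := by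
  have hL : (0 : ℝ) < 2 ^ L := by positivity
  set E : ℝ → Set ℝ := fun c =>
    {x | |x - Int.fract ((2 : ℝ) ^ g * x) - c| ≤ ((K : ℝ) + 1) / 2 ^ L}
  have hE : ∀ c, unitMeasure.real (E c) ≤ 4 * (((K : ℝ) + 1) / 2 ^ L) := fun c => by
    simpa using unitMeasure_return_le (M := 2 ^ g)
      (by simpa using Nat.pow_le_pow_right (n := 2) (by norm_num) hg) c
      (ε := ((K : ℝ) + 1) / 2 ^ L) (by positivity)
  have hsub : {x | DyadicReturn L K g x} ∩ Ico 0 1 ⊆ E 1 ∪ E 0 ∪ E (-1) := by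
    rintro x ⟨hx, h0, h1⟩
    have ht0 := Int.fract_nonneg ((2 : ℝ) ^ g * x)
    have ht1 := Int.fract_lt_one ((2 : ℝ) ^ g * x)
    obtain ⟨q, hq, h⟩ := closeMod_cases hK (floor_two_pow_mul_lt h0 h1)
      (floor_two_pow_mul_lt ht0 ht1) hx
    have hb := mul_floor_bounds hL h0
    have hb' := mul_floor_bounds hL ht0
    have hr : |(⌊(2 : ℝ) ^ L * Int.fract ((2 : ℝ) ^ g * x)⌋₊ : ℝ) - ⌊(2 : ℝ) ^ L * x⌋₊ -
        q * 2 ^ L| ≤ K := by exact_mod_cast h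
    rw [abs_le] at hr
    have key : x ∈ E (-q) := by
      simp only [E, mem_ofPred_eq]
      rw [abs_le, ← neg_div, le_div_iff₀ hL, div_le_iff₀ hL]
      constructor <;> nlinarith [hr.1, hr.2, hb.1, hb.2, hb'.1, hb'.2]
    rcases hq with rfl | rfl | rfl
    · left; left; simpa using key
    · left; right; simpa using key
    · right; simpa using key
  have h1 : unitMeasure.real {x | DyadicReturn L K g x} =
      unitMeasure.real ({x | DyadicReturn L K g x} ∩ Ico 0 1) := by
    rw [unitMeasure_real_apply, unitMeasure_real_apply, inter_assoc, inter_self]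
  rw [h1]
  refine (measureReal_mono hsub).trans ?_
  have h2 := measureReal_union_le (μ := unitMeasure) (E 1 ∪ E 0) (E (-1))
  have h3 := measureReal_union_le (μ := unitMeasure) (E 1) (E 0)
  linarith [hE 1, hE 0, hE (-1)]

/-- If the blocks at `i` and `i + g` are both `K`-close to the first block `w`, the tail `y` after
position `i` makes a `2K`-close return at time `g`, of probability at most `12 * p`. Since `w` is
independent of `y`, its closeness to the block of `y` contributes the other factor `p`. -/
theorem unitMeasure_dyadicReturn_inter_le {L K i j : ℕ} (hK : 2 * K + 1 ≤ 2 ^ L) (hi : L ≤ i)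
    (hij : i < j) :
    unitMeasure.real ({x | DyadicReturn L K i x} ∩ {x | DyadicReturn L K j x}) ≤
      12 * ((2 * K + 1) / 2 ^ L) ^ 2 := by
  classical
  obtain ⟨g, rfl⟩ := Nat.exists_eq_add_of_le hij.le
  have h := unitMeasure_floor_fract_two_pow hi
    (fun w y => CloseMod (2 ^ L) K w ⌊(2 : ℝ) ^ L * y⌋₊ ∧
      CloseMod (2 ^ L) K w ⌊(2 : ℝ) ^ L * Int.fract ((2 : ℝ) ^ g * y)⌋₊)
    fun w => (measurableSet_closeMod measurable_const (measurable_floor_mul _)).inter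
      (measurableSet_closeMod measurable_const (measurable_floor_mul_fract _ _))
  simp only [fract_two_pow_mul_fract] at h
  have hset : {x | DyadicReturn L K i x} ∩ {x | DyadicReturn L K (i + g) x} =
      {x | DyadicReturn L K i x ∧ DyadicReturn L K (i + g) x} := rfl
  rw [hset]
  simp only [DyadicReturn, h]
  set E : Set ℝ := {y | DyadicReturn L (K + K) g y}
  have hEm : MeasurableSet E := measurableSet_dyadicReturn _ _ _
  set C : ℕ → Set ℝ := fun w => E ∩ {y | CloseMod (2 ^ L) K w ⌊(2 : ℝ) ^ L * y⌋₊}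
  have hCm : ∀ w, MeasurableSet (C w) := fun w =>
    hEm.inter (measurableSet_closeMod measurable_const (measurable_floor_mul _))
  have hE : unitMeasure.real E ≤ 12 * ((2 * K + 1) / 2 ^ L) := by
    have := unitMeasure_dyadicReturn_le (L := L) (K := K + K) (g := g) (by omega) (by omega)
    rw [two_mul]
    exact_mod_cast this
  have hle : ∀ w, unitMeasure.real {y | CloseMod (2 ^ L) K w ⌊(2 : ℝ) ^ L * y⌋₊ ∧
      CloseMod (2 ^ L) K w ⌊(2 : ℝ) ^ L * Int.fract ((2 : ℝ) ^ g * y)⌋₊} ≤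
      unitMeasure.real (C w) := fun w =>
    measureReal_mono fun y hy => ⟨hy.1.symm.trans hy.2, hy.1⟩
  -- Sum and integral are exchanged: each `y ∈ E` is counted by exactly `2K + 1` words `w`.
  have hsum : ∑ w ∈ Finset.range (2 ^ L), unitMeasure.real (C w) =
      (2 * K + 1) * unitMeasure.real E := by
    have hint : ∀ w ∈ Finset.range (2 ^ L),
        Integrable ((C w).indicator (1 : ℝ → ℝ)) unitMeasure := fun w _ =>
      (integrable_const 1).indicator (hCm w)
    simp only [← integral_indicator_one (hCm _)]
    rw [← integral_finsetSum _ hint, ← integral_indicator_one hEm, ← integral_const_mul]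
    refine integral_congr_ae (Filter.Eventually.of_forall fun y => ?_)
    simp only
    by_cases hy : y ∈ E
    · have : ∀ w, (C w).indicator (1 : ℝ → ℝ) y =
          if CloseMod (2 ^ L) K ⌊(2 : ℝ) ^ L * y⌋₊ w then 1 else 0 := fun w => by
        simp [C, hy, indicator_apply, closeMod_comm (a := w)]
      simp only [this, Finset.sum_boole, card_closeMod hK, indicator_of_mem hy]
      push_cast
      simp
    · simp [C, hy]
  have h2 := Finset.sum_le_sum fun w (_ : w ∈ Finset.range (2 ^ L)) => hle w
  have hL : (0 : ℝ) < 2 ^ L := by positivity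
  rw [hsum] at h2
  exact (div_le_div_of_nonneg_right (h2.trans (mul_le_mul_of_nonneg_left hE (by positivity)))
    hL.le).trans_eq (by ring)

theorem abs_measureReal_sub_le {S S' E : Set ℝ} (h : ∀ x, x ∉ E → (x ∈ S ↔ x ∈ S')) :
    |unitMeasure.real S - unitMeasure.real S'| ≤ unitMeasure.real E := by
  have key : ∀ A B : Set ℝ, (∀ x, x ∉ E → x ∈ A → x ∈ B) →
      unitMeasure.real A ≤ unitMeasure.real B + unitMeasure.real E := fun A B hAB =>
    (measureReal_mono fun x hx => by
      by_cases hxE : x ∈ E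
      · exact Or.inr hxE
      · exact Or.inl (hAB x hxE hx)).trans (measureReal_union_le B E)
  rw [abs_le]
  constructor
  · linarith [key S' S fun x hE hx => (h x hE).2 hx]
  · linarith [key S S' fun x hE hx => (h x hE).1 hx]

/-! ### Comparison of the dyadic count with a binomial law. -/

open Classical in
/-- The number of dyadic returns of `x` at the times in `s`. -/
noncomputable def dyadicCount (L K : ℕ) (s : Finset ℕ) (x : ℝ) : ℕ :=
  (s.filter fun j => DyadicReturn L K j x).card

theorem measurableSet_dyadicCount (L K : ℕ) (s : Finset ℕ) (k : ℕ) :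
    MeasurableSet {x | dyadicCount L K s x = k} :=
  measurableSet_card_filter_eq (measurableSet_dyadicReturn L K) s k

theorem dyadicCount_Ico_of_not {L K j b : ℕ} {x : ℝ} (hj : j < b) (h : ¬ DyadicReturn L K j x) :
    dyadicCount L K (Finset.Ico j b) x = dyadicCount L K (Finset.Ico (j + 1) b) x := by
  rw [dyadicCount, dyadicCount, ← Finset.insert_Ico_add_one_left_eq_Ico hj,
    Finset.filter_insert, if_neg h]

theorem dyadicCount_Ico_of_mem {L K j b : ℕ} {x : ℝ} (hj : j < b) (h : DyadicReturn L K j x) :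
    dyadicCount L K (Finset.Ico j b) x = dyadicCount L K (Finset.Ico (j + 1) b) x + 1 := by
  rw [dyadicCount, dyadicCount, ← Finset.insert_Ico_add_one_left_eq_Ico hj,
    Finset.filter_insert, if_pos h, Finset.card_insert_of_notMem (by simp)]

/-- The later count is a function of the first block and the digits beyond `j + L` only. -/
theorem unitMeasure_dyadicReturn_inter_count {L K j : ℕ} (hK : 2 * K + 1 ≤ 2 ^ L) (hj : L ≤ j)
    (b k : ℕ) :
    unitMeasure.real ({x | DyadicReturn L K j x} ∩
        {x | dyadicCount L K (Finset.Ico (j + L) b) x = k}) =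
      (2 * K + 1) / 2 ^ L *
        unitMeasure.real {x | dyadicCount L K (Finset.Ico (j + L) b) x = k} := by
  classical
  have h := unitMeasure_dyadicReturn_and hK hj
    (fun w y => ((Finset.Ico (j + L) b).filter fun i => CloseMod (2 ^ L) K w
      ⌊(2 : ℝ) ^ L * Int.fract ((2 : ℝ) ^ (i - (j + L)) * y)⌋₊).card = k)
    fun w => measurableSet_card_filter_eq (fun i => measurableSet_closeMod measurable_const
      (measurable_floor_mul_fract _ _)) _ k
  have hc : ∀ x : ℝ, ((Finset.Ico (j + L) b).filter fun i => CloseMod (2 ^ L) K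
      ⌊(2 : ℝ) ^ L * x⌋₊ ⌊(2 : ℝ) ^ L * Int.fract ((2 : ℝ) ^ (i - (j + L)) *
        Int.fract ((2 : ℝ) ^ (j + L) * x))⌋₊).card =
      dyadicCount L K (Finset.Ico (j + L) b) x := by
    intro x
    rw [dyadicCount]
    congr 1
    refine Finset.filter_congr fun i hi => ?_
    rw [fract_two_pow_mul_fract, Nat.add_sub_cancel' (Finset.mem_Ico.1 hi).1, DyadicReturn]
  simp only [hc] at h
  exact h

/-- Skipping the times strictly between `j` and `j + L` makes the independence exact. The skip costs
`12 * L * p^2` on the intersection, by the pair bound, and `p * (L * p)` in the product. -/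
theorem abs_dyadicReturn_inter_count_sub_le {L K j : ℕ} (hL : 1 ≤ L) (hK : 2 * K + 1 ≤ 2 ^ L)
    (hj : L ≤ j) (b k : ℕ) :
    |unitMeasure.real ({x | DyadicReturn L K j x} ∩
        {x | dyadicCount L K (Finset.Ico (j + 1) b) x = k}) -
      (2 * K + 1) / 2 ^ L *
        unitMeasure.real {x | dyadicCount L K (Finset.Ico (j + 1) b) x = k}| ≤
      13 * L * ((2 * K + 1) / 2 ^ L) ^ 2 := by
  set p : ℝ := (2 * K + 1) / 2 ^ L with hp
  have hp0 : 0 ≤ p := by positivity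
  set D : ℕ → Set ℝ := fun i => {x | DyadicReturn L K i x}
  set E : Set ℝ := ⋃ i ∈ Finset.Ico (j + 1) (j + L), D i with hE
  have hcount : ∀ x, x ∉ E → dyadicCount L K (Finset.Ico (j + 1) b) x =
      dyadicCount L K (Finset.Ico (j + L) b) x := by
    intro x hx
    rw [dyadicCount, dyadicCount]
    congr 1
    ext i
    simp only [Finset.mem_filter, Finset.mem_Ico]
    constructor
    · rintro ⟨⟨h1, h2⟩, h3⟩
      refine ⟨⟨?_, h2⟩, h3⟩
      by_contra h4
      exact hx (mem_biUnion (Finset.mem_coe.2 (Finset.mem_Ico.2 ⟨h1, not_le.1 h4⟩)) h3)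
    · rintro ⟨⟨h1, h2⟩, h3⟩
      exact ⟨⟨by omega, h2⟩, h3⟩
  have hcard : ((Finset.Ico (j + 1) (j + L)).card : ℝ) ≤ L := by
    rw [Nat.card_Ico]
    exact_mod_cast (by omega : j + L - (j + 1) ≤ L)
  have hEp : unitMeasure.real E ≤ L * p := by
    refine (measureReal_biUnion_finset_le _ _).trans ?_
    rw [Finset.sum_congr rfl fun i hi => unitMeasure_dyadicReturn hK
      (hj.trans ((Nat.le_succ j).trans (Finset.mem_Ico.1 hi).1)), Finset.sum_const, nsmul_eq_mul]
    gcongr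
  have hDE : unitMeasure.real (D j ∩ E) ≤ L * (12 * p ^ 2) := by
    rw [hE, inter_iUnion₂]
    refine (measureReal_biUnion_finset_le _ _).trans ?_
    refine (Finset.sum_le_card_nsmul _ _ (12 * p ^ 2) fun i hi =>
      unitMeasure_dyadicReturn_inter_le hK hj (Finset.mem_Ico.1 hi).1).trans ?_
    rw [nsmul_eq_mul]
    gcongr
  have h1 := abs_measureReal_sub_le (S := D j ∩ {x | dyadicCount L K (Finset.Ico (j + 1) b) x = k})
    (S' := D j ∩ {x | dyadicCount L K (Finset.Ico (j + L) b) x = k}) (E := D j ∩ E) fun x hx => by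
      simp only [mem_inter_iff, mem_ofPred_eq]
      refine and_congr_right fun hxD => ?_
      rw [hcount x fun hxE => hx ⟨hxD, hxE⟩]
  have h2 := abs_measureReal_sub_le (S := {x | dyadicCount L K (Finset.Ico (j + 1) b) x = k})
    (S' := {x | dyadicCount L K (Finset.Ico (j + L) b) x = k}) (E := E) fun x hx => by
      simp only [mem_ofPred_eq, hcount x hx]
  rw [unitMeasure_dyadicReturn_inter_count hK hj, ← hp] at h1
  have h3 := mul_le_mul_of_nonneg_left (h2.trans hEp) hp0
  rw [← abs_of_nonneg hp0, ← abs_mul, abs_of_nonneg hp0] at h3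
  have h1' := abs_le.1 (h1.trans hDE)
  have h3' := abs_le.1 h3
  rw [abs_le]
  constructor <;> nlinarith

/-- The probability that a binomial random variable takes the value `k`. -/
noncomputable def binomialWeight (p : ℝ) (m k : ℕ) : ℝ :=
  m.choose k * p ^ k * (1 - p) ^ (m - k)

theorem binomialWeight_succ_zero (p : ℝ) (m : ℕ) :
    binomialWeight p (m + 1) 0 = (1 - p) * binomialWeight p m 0 := by
  simp [binomialWeight, pow_succ']

theorem binomialWeight_succ_succ (p : ℝ) (m k : ℕ) :
    binomialWeight p (m + 1) (k + 1) =
      (1 - p) * binomialWeight p m (k + 1) + p * binomialWeight p m k := by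
  simp only [binomialWeight, Nat.choose_succ_succ' m k, Nat.add_sub_add_right]
  rcases lt_or_ge k m with h | h
  · rw [show m - k = m - (k + 1) + 1 by omega]
    push_cast
    ring
  · rw [Nat.choose_eq_zero_of_lt (show m < k + 1 by omega)]
    push_cast
    ring

/-- Conditioning on the first time `j` reproduces the Pascal recursion of `binomialWeight`. Its
weights `1 - p` and `p` sum to `1`, so old errors are not amplified, and each step adds at most two
decoupling errors `13 * L * p^2`. -/
theorem abs_dyadicCount_sub_binomialWeight_le {L K : ℕ} (hL : 1 ≤ L) (hK : 2 * K + 1 ≤ 2 ^ L)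
    (m : ℕ) : ∀ j k : ℕ, L ≤ j →
    |unitMeasure.real {x | dyadicCount L K (Finset.Ico j (j + m)) x = k} -
      binomialWeight ((2 * K + 1) / 2 ^ L) m k| ≤ m * (26 * L * ((2 * K + 1) / 2 ^ L) ^ 2) := by
  set p : ℝ := (2 * K + 1) / 2 ^ L with hp
  have hp0 : 0 ≤ p := by positivity
  have hp1 : p ≤ 1 := by
    rw [hp, div_le_one (by positivity)]
    exact_mod_cast hK
  induction m with
  | zero =>
    intro j k _
    cases k <;> simp [dyadicCount, binomialWeight]
  | succ m ih =>
    intro j k hj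
    have hb : j < j + (m + 1) := by omega
    set D : Set ℝ := {x | DyadicReturn L K j x}
    have hDm : MeasurableSet D := measurableSet_dyadicReturn _ _ _
    set S : ℕ → Set ℝ := fun i => {x | dyadicCount L K (Finset.Ico (j + 1) (j + (m + 1))) x = i}
    have hSm : ∀ i, MeasurableSet (S i) := fun i => measurableSet_dyadicCount _ _ _ _
    have herr : ∀ i, |unitMeasure.real (D ∩ S i) - p * unitMeasure.real (S i)| ≤ 13 * L * p ^ 2 :=
      fun i => abs_dyadicReturn_inter_count_sub_le hL hK hj _ i
    have hS : ∀ i, |unitMeasure.real (S i) - binomialWeight p m i| ≤ m * (26 * L * p ^ 2) := by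
      intro i
      have := ih (j + 1) i (by omega)
      rwa [show j + 1 + m = j + (m + 1) by omega] at this
    have hsplit : ∀ i, unitMeasure.real (S i \ D) =
        unitMeasure.real (S i) - unitMeasure.real (D ∩ S i) := fun i => by
      have := measureReal_inter_add_sdiff (μ := unitMeasure) (s := S i) hDm
      rw [inter_comm D]
      linarith
    have hLp : 0 ≤ 13 * L * p ^ 2 := by positivity
    cases k with
    | zero =>
      have hset : {x | dyadicCount L K (Finset.Ico j (j + (m + 1))) x = 0} = S 0 \ D := by
        ext x
        by_cases hx : DyadicReturn L K j x
        · simp [S, D, hx, dyadicCount_Ico_of_mem hb hx]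
        · simp [S, D, hx, dyadicCount_Ico_of_not hb hx]
      rw [hset, hsplit, binomialWeight_succ_zero]
      have h1 := abs_le.1 (herr 0)
      have h2 := abs_le.1 (hS 0)
      push_cast
      rw [abs_le]
      constructor <;> nlinarith
    | succ k =>
      have hset : {x | dyadicCount L K (Finset.Ico j (j + (m + 1))) x = k + 1} =
          (S (k + 1) \ D) ∪ (D ∩ S k) := by
        ext x
        by_cases hx : DyadicReturn L K j x
        · simp [S, D, hx, dyadicCount_Ico_of_mem hb hx]
        · simp [S, D, hx, dyadicCount_Ico_of_not hb hx]
      rw [hset, measureReal_union (disjoint_sdiff_left.mono_right inter_subset_left)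
        (hDm.inter (hSm k)), hsplit, binomialWeight_succ_succ]
      have h1 := abs_le.1 (herr k)
      have h2 := abs_le.1 (hS k)
      have h1' := abs_le.1 (herr (k + 1))
      have h2' := abs_le.1 (hS (k + 1))
      push_cast
      rw [abs_le]
      constructor <;> nlinarith

/-! ### From true returns to dyadic returns. -/

/-- Away from the end points of the interval and from the critical distance `r`, the dyadic
return at scale `2 ^ (-L)` detects exactly the returns at distance at most `r`. -/
theorem dyadicReturn_iff {L j : ℕ} {r x : ℝ} (hr : 0 ≤ r) (hK : ⌊r * 2 ^ L⌋₊ < 2 ^ L)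
    (h0 : r + 1 / 2 ^ L ≤ x) (h1 : x ≤ 1 - (r + 1 / 2 ^ L))
    (hx : 1 / 2 ^ L < |(|x - Int.fract ((2 : ℝ) ^ j * x)| - r)|) :
    DyadicReturn L ⌊r * 2 ^ L⌋₊ j x ↔ |x - Int.fract ((2 : ℝ) ^ j * x)| ≤ r := by
  have hM : (0 : ℝ) < 2 ^ L := by positivity
  have hMδ : (2 : ℝ) ^ L * (1 / 2 ^ L) = 1 := by field_simp
  have hδ : (0 : ℝ) < 1 / 2 ^ L := by positivity
  set δ : ℝ := 1 / 2 ^ L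
  have hx0 : 0 ≤ x := by linarith
  have hx1 : x < 1 := by linarith
  have ht0 := Int.fract_nonneg ((2 : ℝ) ^ j * x)
  have ht1 := Int.fract_lt_one ((2 : ℝ) ^ j * x)
  have hb := mul_floor_bounds hM hx0
  have hb' := mul_floor_bounds hM ht0
  have hz := floor_two_pow_mul_lt (L := L) hx0 hx1
  have hy := floor_two_pow_mul_lt (L := L) ht0 ht1
  rw [DyadicReturn]
  set t := Int.fract ((2 : ℝ) ^ j * x)
  set z := ⌊(2 : ℝ) ^ L * x⌋₊
  set y := ⌊(2 : ℝ) ^ L * t⌋₊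
  have hKr : ((⌊r * 2 ^ L⌋₊ : ℕ) : ℝ) ≤ r * 2 ^ L := Nat.floor_le (by positivity)
  constructor
  · intro h
    obtain ⟨q, hq, h⟩ := closeMod_cases hK hz hy h
    have h' : |(y : ℝ) - z - q * 2 ^ L| ≤ r * 2 ^ L := by
      refine le_trans ?_ hKr
      exact_mod_cast h
    rw [abs_le] at h'
    have hlt : ∀ s : ℝ, s * 2 ^ L < (r + δ) * 2 ^ L → s < r + δ := fun s hs =>
      lt_of_mul_lt_mul_right hs hM.le
    -- Wrapping (`q = ±1`) would put `x` within `r + δ` of an end point. Without it, rounding gives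
    -- `|x - t| < r + δ`, and the gap around `r` improves this to `r`.
    rcases hq with rfl | rfl | rfl
    · exfalso
      push_cast at h'
      have := hlt (t - x + 1) (by nlinarith [h'.2])
      linarith
    · push_cast at h'
      have e1 := hlt (t - x) (by nlinarith [h'.2])
      have e2 := hlt (x - t) (by nlinarith [h'.1])
      by_contra hlt'
      push Not at hlt'
      rw [abs_of_pos (by linarith)] at hx
      have : |x - t| < r + δ := abs_lt.2 ⟨by linarith, e2⟩
      linarith
    · exfalso
      push_cast at h'
      have := hlt (x - t + 1) (by nlinarith [h'.1])
      linarith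
  · intro h
    -- The gap gives `|x - t| < r - δ`, which leaves room for the rounding error of the two floors.
    rw [abs_of_nonpos (by linarith)] at hx
    have h2 : |x - t| < r - δ := by linarith
    rw [abs_lt] at h2
    refine ⟨(y : ℤ) - z, ?_, by simp⟩
    have h3 : |(y : ℝ) - z| ≤ r * 2 ^ L := by
      rw [abs_le]
      have e1 := mul_lt_mul_of_pos_right h2.1 hM
      have e2 := mul_lt_mul_of_pos_right h2.2 hM
      constructor <;> nlinarith
    have h4 : (((y : ℤ) - z).natAbs : ℝ) ≤ r * 2 ^ L := by
      rw [Nat.cast_natAbs]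
      push_cast
      exact h3
    rw [Int.abs_eq_natAbs]
    exact_mod_cast Nat.le_floor h4

theorem unitMeasure_lt_le {c : ℝ} (hc : 0 ≤ c) : unitMeasure.real {x | x < c} ≤ c := by
  rw [unitMeasure_real_apply]
  refine (measureReal_mono (s₂ := Icc 0 c) (fun x hx => ⟨hx.2.1, le_of_lt hx.1⟩)
    (by simp)).trans ?_
  rw [Real.volume_real_Icc_of_le hc, sub_zero]

theorem unitMeasure_gt_le {c : ℝ} (hc : 0 ≤ c) : unitMeasure.real {x | 1 - c < x} ≤ c := by
  rw [unitMeasure_real_apply]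
  refine (measureReal_mono (s₂ := Icc (1 - c) 1) (fun x hx => ⟨le_of_lt hx.1, hx.2.2.le⟩)
    (by simp)).trans ?_
  rw [Real.volume_real_Icc_of_le (by linarith)]
  linarith

theorem unitMeasure_two_pow_return_le {j : ℕ} (hj : 1 ≤ j) (c : ℝ) {ε : ℝ} (hε : 0 ≤ ε) :
    unitMeasure.real {x | |x - Int.fract ((2 : ℝ) ^ j * x) - c| ≤ ε} ≤ 4 * ε := by
  simpa using unitMeasure_return_le (M := 2 ^ j)
    (by simpa using Nat.pow_le_pow_right (n := 2) (by norm_num) hj) c hε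

theorem unitMeasure_critical_le {j : ℕ} (hj : 1 ≤ j) (r : ℝ) {ε : ℝ} (hε : 0 ≤ ε) :
    unitMeasure.real {x | |(|x - Int.fract ((2 : ℝ) ^ j * x)| - r)| ≤ ε} ≤ 8 * ε := by
  have hsub : {x : ℝ | |(|x - Int.fract ((2 : ℝ) ^ j * x)| - r)| ≤ ε} ⊆
      {x | |x - Int.fract ((2 : ℝ) ^ j * x) - r| ≤ ε} ∪
        {x | |x - Int.fract ((2 : ℝ) ^ j * x) - (-r)| ≤ ε} := by
    intro x hx
    simp only [mem_ofPred_eq] at hx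
    rcases abs_cases (x - Int.fract ((2 : ℝ) ^ j * x)) with h | h
    · left; rwa [h.1] at hx
    · right
      rw [h.1, ← abs_neg] at hx
      rw [mem_ofPred_eq]
      convert hx using 2
      ring
  have h1 := (measureReal_mono (μ := unitMeasure) hsub).trans (measureReal_union_le _ _)
  linarith [unitMeasure_two_pow_return_le hj r hε, unitMeasure_two_pow_return_le hj (-r) hε]

open Classical in
/-- The number of returns of `x` at distance at most `r` up to time `n`, in terms of the explicit
formula for the iterates of the doubling map. -/
noncomputable def returnCount (n : ℕ) (r x : ℝ) : ℕ :=
  ((Finset.Icc 1 n).filter fun j : ℕ => |x - Int.fract ((2 : ℝ) ^ j * x)| ≤ r).card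

theorem measurableSet_returnCount (n : ℕ) (r : ℝ) (k : ℕ) :
    MeasurableSet {x | returnCount n r x = k} :=
  measurableSet_card_filter_eq (fun _ => measurableSet_le
    ((measurable_id.sub (measurable_fract.comp (measurable_const_mul _))).abs)
    measurable_const) _ k

/-- The window `[L, L + n)` has exactly `n` times, all late enough for independence. The counts can
differ only through a return before `L`, a dyadic return after `n`, a distance within `δ` of `r`, or
`x` near an end point; these are `E₁`, `E₂`, `E₃` and `E₄ ∪ E₅`. -/
theorem abs_returnCount_sub_dyadicCount_le {L n : ℕ} {r : ℝ} (hL : 1 ≤ L) (hn : L ≤ n)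
    (hr : 0 ≤ r) (hK : 2 * ⌊r * 2 ^ L⌋₊ + 1 ≤ 2 ^ L) (k : ℕ) :
    |unitMeasure.real {x | returnCount n r x = k} -
      unitMeasure.real {x | dyadicCount L ⌊r * 2 ^ L⌋₊ (Finset.Ico L (L + n)) x = k}| ≤
      L * (4 * r) + L * ((2 * ⌊r * 2 ^ L⌋₊ + 1) / 2 ^ L) + 2 * (r + 1 / 2 ^ L) +
        n * (8 * (1 / 2 ^ L)) := by
  set K := ⌊r * 2 ^ L⌋₊ with hKdef
  have hδ : (0 : ℝ) < 1 / 2 ^ L := by positivity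
  set δ : ℝ := 1 / 2 ^ L with hδdef
  set p : ℝ := (2 * K + 1) / 2 ^ L with hp
  have hp0 : 0 ≤ p := by positivity
  set E₁ : Set ℝ := ⋃ j ∈ Finset.Ico 1 L, {x | |x - Int.fract ((2 : ℝ) ^ j * x) - 0| ≤ r}
  set E₂ : Set ℝ := ⋃ j ∈ Finset.Ico (n + 1) (L + n), {x | DyadicReturn L K j x}
  set E₃ : Set ℝ := ⋃ j ∈ Finset.Icc L n, {x | |(|x - Int.fract ((2 : ℝ) ^ j * x)| - r)| ≤ δ}
  set E₄ : Set ℝ := {x | x < r + δ}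
  set E₅ : Set ℝ := {x | 1 - (r + δ) < x}
  have b₁ : unitMeasure.real E₁ ≤ L * (4 * r) := by
    refine (measureReal_biUnion_finset_le _ _).trans ((Finset.sum_le_card_nsmul _ _ (4 * r)
      fun j hj => unitMeasure_two_pow_return_le (Finset.mem_Ico.1 hj).1 0 hr).trans ?_)
    rw [nsmul_eq_mul, Nat.card_Ico]
    gcongr
    omega
  have b₂ : unitMeasure.real E₂ ≤ L * p := by
    refine (measureReal_biUnion_finset_le _ _).trans ((Finset.sum_le_card_nsmul _ _ p
      fun j hj => (unitMeasure_dyadicReturn hK (by have := Finset.mem_Ico.1 hj; omega)).le).trans ?_)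
    rw [nsmul_eq_mul, Nat.card_Ico]
    gcongr
    omega
  have b₃ : unitMeasure.real E₃ ≤ n * (8 * δ) := by
    refine (measureReal_biUnion_finset_le _ _).trans ((Finset.sum_le_card_nsmul _ _ (8 * δ)
      fun j hj => unitMeasure_critical_le (hL.trans (Finset.mem_Icc.1 hj).1) r hδ.le).trans ?_)
    rw [nsmul_eq_mul, Nat.card_Icc]
    gcongr
    omega
  have b₄ : unitMeasure.real E₄ ≤ r + δ := unitMeasure_lt_le (by positivity)
  have b₅ : unitMeasure.real E₅ ≤ r + δ := unitMeasure_gt_le (by positivity)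
  have key : ∀ x, x ∉ E₁ ∪ E₂ ∪ E₃ ∪ E₄ ∪ E₅ →
      returnCount n r x = dyadicCount L K (Finset.Ico L (L + n)) x := by
    intro x hx
    simp only [mem_union, not_or] at hx
    obtain ⟨⟨⟨⟨h₁, h₂⟩, h₃⟩, h₄⟩, h₅⟩ := hx
    have h₁' : ∀ j, 1 ≤ j → j < L → ¬ |x - Int.fract ((2 : ℝ) ^ j * x)| ≤ r := by
      intro j hj hj' h
      exact h₁ (mem_biUnion (Finset.mem_coe.2 (Finset.mem_Ico.2 ⟨hj, hj'⟩)) (by simpa using h))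
    have h₂' : ∀ j, n < j → j < L + n → ¬ DyadicReturn L K j x := by
      intro j hj hj' h
      exact h₂ (mem_biUnion (Finset.mem_coe.2 (Finset.mem_Ico.2 ⟨hj, hj'⟩)) h)
    have h₃' : ∀ j, L ≤ j → j ≤ n →
        (DyadicReturn L K j x ↔ |x - Int.fract ((2 : ℝ) ^ j * x)| ≤ r) := by
      intro j hj hj'
      refine dyadicReturn_iff hr (by omega) (not_lt.1 h₄) (not_lt.1 h₅) (not_le.1 fun h => ?_)
      exact h₃ (mem_biUnion (Finset.mem_coe.2 (Finset.mem_Icc.2 ⟨hj, hj'⟩)) h)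
    rw [returnCount, dyadicCount]
    congr 1
    ext j
    simp only [Finset.mem_filter, Finset.mem_Icc, Finset.mem_Ico]
    constructor
    · rintro ⟨⟨hj, hj'⟩, h⟩
      have hLj : L ≤ j := not_lt.1 fun hlt => h₁' j hj hlt h
      exact ⟨⟨hLj, by omega⟩, (h₃' j hLj hj').2 h⟩
    · rintro ⟨⟨hj, hj'⟩, h⟩
      have hjn : j ≤ n := not_lt.1 fun hlt => h₂' j hlt hj' h
      exact ⟨⟨by omega, hjn⟩, (h₃' j hj hjn).1 h⟩
  refine (abs_measureReal_sub_le (E := E₁ ∪ E₂ ∪ E₃ ∪ E₄ ∪ E₅) fun x hx => by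
    simp only [mem_ofPred_eq, key x hx]).trans ?_
  linarith [measureReal_union_le (μ := unitMeasure) (E₁ ∪ E₂ ∪ E₃ ∪ E₄) E₅,
    measureReal_union_le (μ := unitMeasure) (E₁ ∪ E₂ ∪ E₃) E₄,
    measureReal_union_le (μ := unitMeasure) (E₁ ∪ E₂) E₃,
    measureReal_union_le (μ := unitMeasure) E₁ E₂]

/-! ### Transfer to the doubling map on `unitInterval`. -/

theorem doublingMap_iterate_coe (x : unitInterval) {j : ℕ} (hj : 1 ≤ j) :
    ((doublingMap^[j] x : unitInterval) : ℝ) = Int.fract ((2 : ℝ) ^ j * (x : ℝ)) := by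
  induction j, hj using Nat.le_induction with
  -- The induction starts at `1`: for `j = 0` the formula fails at `x = 1`, whose fractional part is
  -- `0`.
  | base => simp [doublingMap]
  | succ j _ ih =>
    rw [Function.iterate_succ_apply', doublingMap]
    simp only [ih]
    simpa using fract_two_pow_mul_fract j 1 (x : ℝ)

theorem recurrenceCount_doublingMap (n : ℕ) (r : ℝ) (x : unitInterval) :
    recurrenceCount doublingMap n r x = returnCount n r (x : ℝ) := by
  rw [recurrenceCount, returnCount]
  congr 1
  refine Finset.filter_congr fun j hj => ?_
  rw [Subtype.dist_eq, Real.dist_eq, doublingMap_iterate_coe x (Finset.mem_Icc.1 hj).1]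

theorem volume_recurrenceCount (n : ℕ) (r : ℝ) (k : ℕ) :
    (volume : Measure unitInterval).real {x | recurrenceCount doublingMap n r x = k} =
      unitMeasure.real {x | returnCount n r x = k} := by
  have h := unitInterval.measurePreserving_coe.measureReal_preimage
    (measurableSet_returnCount n r k).nullMeasurableSet
  rw [unitMeasure, Measure.restrict_congr_set (Ico_ae_eq_Icc (μ := volume) (a := (0 : ℝ)) (b := 1)),
    ← show unitInterval = Icc (0 : ℝ) 1 from rfl, ← h]
  simp only [recurrenceCount_doublingMap]
  rfl

/-! ### Asymptotics with `L = ⌊√n⌋` and the Poisson limit. -/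

open Filter Topology

theorem tendsto_natSqrt_atTop : Tendsto Nat.sqrt atTop atTop :=
  tendsto_atTop_atTop.2 fun b => ⟨b * b, fun _ hn => Nat.le_sqrt.2 hn⟩

theorem tendsto_natSqrt_div : Tendsto (fun n : ℕ => (Nat.sqrt n : ℝ) / n) atTop (𝓝 0) := by
  refine squeeze_zero (fun n => by positivity) (fun n => ?_)
    (tendsto_inv_atTop_nhds_zero_nat.comp tendsto_natSqrt_atTop)
  rcases Nat.eq_zero_or_pos (Nat.sqrt n) with h | h
  · simp [h]
  · have h1 : (0 : ℝ) < Nat.sqrt n := by exact_mod_cast h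
    have h2 : (Nat.sqrt n : ℝ) * Nat.sqrt n ≤ n := by exact_mod_cast Nat.sqrt_le n
    simp only [Function.comp]
    rw [← one_div, div_le_div_iff₀ (by nlinarith) h1]
    linarith

theorem tendsto_mul_two_pow_natSqrt :
    Tendsto (fun n : ℕ => (n : ℝ) * (1 / 2 ^ Nat.sqrt n)) atTop (𝓝 0) := by
  -- With `s = ⌊√n⌋`, `n ≤ (s + 1)^2`, and `(s + 1)^2 / 2^s = 2 * ((s + 1)^2 / 2^(s + 1))`; hence
  -- the shift by `1` and the factor `2`.
  have h := ((tendsto_add_atTop_iff_nat 1).2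
    (tendsto_pow_const_div_const_pow_of_one_lt 2 (one_lt_two (α := ℝ)))).const_mul 2
  rw [mul_zero] at h
  refine squeeze_zero (fun n => by positivity) (fun n => ?_) (h.comp tendsto_natSqrt_atTop)
  have h1 : (n : ℝ) ≤ (Nat.sqrt n + 1) ^ 2 := by
    exact_mod_cast (sq (Nat.sqrt n + 1) ▸ (Nat.lt_succ_sqrt n).le)
  simp only [Function.comp]
  push_cast
  rw [pow_succ (2 : ℝ), mul_one_div, mul_div_assoc', mul_comm _ (2 : ℝ),
    mul_div_mul_left _ _ two_ne_zero]
  gcongr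

theorem mainTheorem5 (τ : ℝ) (hτ : 0 < τ) (k : ℕ) :
    Filter.Tendsto
      (fun n : ℕ =>
        (MeasureTheory.volume : MeasureTheory.Measure unitInterval).real
          {x : unitInterval | recurrenceCount doublingMap n (τ / (2 * (n : ℝ))) x = k})
      Filter.atTop
      (nhds (τ ^ k / (Nat.factorial k : ℝ) * Real.exp (-τ))) := by
  set r : ℕ → ℝ := fun n => τ / (2 * (n : ℝ)) with hr
  set L : ℕ → ℕ := Nat.sqrt with hL
  set δ : ℕ → ℝ := fun n => 1 / 2 ^ L n with hδ
  set K : ℕ → ℕ := fun n => ⌊r n * 2 ^ L n⌋₊ with hK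
  set p : ℕ → ℝ := fun n => (2 * K n + 1) / 2 ^ L n with hp
  have hr0 : ∀ n, 0 ≤ r n := fun n => by positivity
  have hnr : ∀ n : ℕ, 1 ≤ n → (n : ℝ) * r n = τ / 2 := fun n hn => by
    have : (n : ℝ) ≠ 0 := by positivity
    simp only [hr]; field_simp
  -- As `K ≤ r * 2^L < K + 1`, the odd number `2K + 1` is within `1` of `2 * r * 2^L`.
  have hpr : ∀ n, |p n - 2 * r n| ≤ δ n := fun n => by
    have hM : (0 : ℝ) < 2 ^ L n := by positivity
    have h1 : (K n : ℝ) ≤ r n * 2 ^ L n := Nat.floor_le (mul_nonneg (hr0 n) hM.le)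
    have h2 : r n * 2 ^ L n < K n + 1 := Nat.lt_floor_add_one _
    have h3 : p n - 2 * r n = (2 * K n + 1 - 2 * (r n * 2 ^ L n)) / 2 ^ L n := by
      simp only [hp]; field_simp
    rw [h3, abs_div, abs_of_pos hM]
    refine div_le_div_of_nonneg_right (abs_le.2 ⟨?_, ?_⟩) hM.le <;> linarith
  have hnδ : Tendsto (fun n : ℕ => (n : ℝ) * δ n) atTop (𝓝 0) := tendsto_mul_two_pow_natSqrt
  have hLn : Tendsto (fun n : ℕ => (L n : ℝ) / n) atTop (𝓝 0) := tendsto_natSqrt_div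
  have hnp : Tendsto (fun n : ℕ => (n : ℝ) * p n) atTop (𝓝 τ) := by
    refine tendsto_iff_norm_sub_tendsto_zero.2 (squeeze_zero' (Eventually.of_forall fun n =>
      norm_nonneg _) ?_ hnδ)
    filter_upwards [eventually_ge_atTop 1] with n hn
    have : (n : ℝ) * p n - τ = n * (p n - 2 * r n) := by
      have := hnr n hn; linarith
    rw [this, Real.norm_eq_abs, abs_mul, Nat.abs_cast]
    exact mul_le_mul_of_nonneg_left (hpr n) (Nat.cast_nonneg n)
  have hr_lim : Tendsto r atTop (𝓝 0) := by
    have := (tendsto_const_div_atTop_nhds_zero_nat (τ / 2))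
    refine this.congr fun n => ?_
    simp only [hr]; rw [div_div]
  have hδ_lim : Tendsto δ atTop (𝓝 0) := by
    refine squeeze_zero' (Eventually.of_forall fun n => by positivity) ?_ hnδ
    filter_upwards [eventually_ge_atTop 1] with n hn
    have h1 : (1 : ℝ) ≤ n := by exact_mod_cast hn
    have h2 : 0 ≤ δ n := by positivity
    nlinarith
  have hp1 : ∀ᶠ n in atTop, 2 * K n + 1 ≤ 2 ^ L n := by
    have h : Tendsto (fun n => 2 * r n + δ n) atTop (𝓝 0) := by
      simpa using (hr_lim.const_mul 2).add hδ_lim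
    filter_upwards [h.eventually_lt_const zero_lt_one] with n hn
    have h1 : p n ≤ 1 := by linarith [(abs_le.1 (hpr n)).2]
    have hM : (0 : ℝ) < 2 ^ L n := by positivity
    rw [div_le_one hM] at h1
    exact_mod_cast h1
  have hbin : Tendsto (fun n : ℕ => binomialWeight (p n) n k) atTop
      (𝓝 (τ ^ k / (Nat.factorial k : ℝ) * Real.exp (-τ))) := by
    rw [mul_comm, ← mul_div_assoc]
    exact ProbabilityTheory.tendsto_choose_mul_pow_of_tendsto_mul_atTop k hnp
  -- This is the sum of the two error bounds with `L / n` factored out; `2 * τ` stands for `4 * (n *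
  -- r)`.
  have herr : Tendsto (fun n : ℕ => (L n : ℝ) / n * (2 * τ + n * p n + 26 * (n * p n) ^ 2) +
      2 * (r n + δ n) + 8 * (n * δ n)) atTop (𝓝 0) := by
    have h1 := hLn.mul ((hnp.const_add (2 * τ)).add ((hnp.pow 2).const_mul 26))
    simpa using (h1.add ((hr_lim.add hδ_lim).const_mul 2)).add (hnδ.const_mul 8)
  refine tendsto_of_tendsto_of_dist hbin (squeeze_zero' (Eventually.of_forall fun n =>
    dist_nonneg) ?_ herr)
  filter_upwards [hp1, eventually_ge_atTop 1] with n hKn hn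
  have hL1 : 1 ≤ L n := Nat.sqrt_pos.2 hn
  have hn0 : (n : ℝ) ≠ 0 := by positivity
  have h1 := abs_returnCount_sub_dyadicCount_le hL1 (Nat.sqrt_le_self n) (hr0 n) hKn k
  have h2 := abs_dyadicCount_sub_binomialWeight_le hL1 hKn n (L n) k le_rfl
  rw [volume_recurrenceCount, dist_comm, Real.dist_eq]
  refine (abs_sub_le _ _ _).trans ((add_le_add h1 h2).trans (le_of_eq ?_))
  change (L n : ℝ) * (4 * r n) + L n * p n + 2 * (r n + δ n) + n * (8 * δ n) +
    n * (26 * L n * p n ^ 2) = _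
  have h3 : 2 * τ = 4 * (n * r n) := by rw [hnr n hn]; ring
  rw [h3]
  field_simp
  ring
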